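/- A repetition is a finite sequence $x_1 \dots x_{2t}$ with $t \ge 1$ such that $x_i = x_{t+i}$ for all $1 \le i \le t$. A sequence is called Thue if no block of consecutive terms of it is a repetition. For a sequence $\varphi = x_1 \dots x_n$ and positive integers $d$ and $i \le n$, the subsequence $x_i x_{i+d} x_{i+2d} \dots$ (continued as long as the index is at most $n$) is called a $d$-subsequence of $\varphi$. A sequence is $k$-Thue if each of its $d$-subsequences with $1 \le d \le k$ is Thue. Theorem 2. For any $k \in \{4,5,6,7,8\}$, $k+2$ distinct symbols suffice to construct a $k$-Thue sequence of any length. That is, for every alphabet $\mathbb{A}$ with exactly $k+2$ elements and every integer $n \ge 0$ there is a $k$-Thue sequence of length $n$ all of whose terms lie in $\mathbb{A}$. -/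

import Mathlib

/-- A repetition: a sequence `x₁ … x₂ₜ` (with `t ≥ 1`) whose first half equals its second half. -/
def IsRepetition {A : Type*} (r : List A) : Prop :=
  ∃ u : List A, u ≠ [] ∧ r = u ++ u

/-- A (finite) sequence is Thue, or non-repetitive, if no block of consecutive terms of it
is a repetition. -/
def IsThue {A : Type*} (w : List A) : Prop :=
  ∀ r : List A, r <:+: w → ¬ IsRepetition r

/-- The `d`-subsequence `xᵢ xᵢ₊d xᵢ₊₂d …` of the sequence `w`, with terms indexed from `0`;
indices that are not smaller than the length of `w` contribute nothing. For `d ≥ 1` the terms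
`xᵢ₊ⱼd` that exist all have `j < w.length`. -/
def dSubsequence {A : Type*} (w : List A) (d i : ℕ) : List A :=
  (List.range w.length).filterMap fun j => w[i + j * d]?

/-- A sequence is `k`-Thue if each of its `d`-subsequences with `1 ≤ d ≤ k` is Thue. -/
def IsKThue {A : Type*} (k : ℕ) (w : List A) : Prop :=
  ∀ d : ℕ, 1 ≤ d → d ≤ k → ∀ i : ℕ, i < w.length → IsThue (dSubsequence w d i)

/-! A square-free ternary word `w` is sent through a uniform morphism of length `L` into the larger
alphabet. Suppose a `d`-subsequence of the image, `d ≤ k`, contains a repetition with halves of `t`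
terms, so that positions `t * d` apart agree.

If `L ∣ t * d`, corresponding blocks agree along a progression through half a block; distinct code
words differ there (`sep`), so the repetition pulls back to a square in `w`. If `L ∤ t * d` and `t *
d ≥ 2 * L`, the first half crosses a whole block, which would match the image of two letters at a
nonzero offset, against `sync`. Otherwise the repetition fits inside five blocks, leaving finitely
many cases (`short`).

These conditions are finite and are checked by arithmetic on words packed into large numbers. A
morphism with `k = 1` from ternary to ternary words, iterated, supplies `w`. -/

/-- The word `x` satisfies, on its first `N` terms, that none of its `d`-subsequences with
`1 ≤ d ≤ k` contains a repetition. -/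
def Nonrep {α : Type*} (k N : ℕ) (x : ℕ → α) : Prop :=
  ∀ d t i : ℕ, 1 ≤ d → d ≤ k → 1 ≤ t → i + 2 * (t * d) < N + d →
    ∃ j < t, x (i + j * d) ≠ x (i + j * d + t * d)

/-! ### Words encoded as hexadecimal numbers -/

/-- The `p`-th hexadecimal digit of `X`, counted from the least significant one. -/
def hexDigit (X p : ℕ) : ℕ := X / 16 ^ p % 16

/-- A number whose bit `4 * p` is set only if the `p`-th hexadecimal digits of `X` and `Y`
differ. -/
def mismatch (X Y : ℕ) : ℕ :=
  (X ^^^ Y) ||| ((X ^^^ Y) >>> 1 ||| ((X ^^^ Y) >>> 2 ||| (X ^^^ Y) >>> 3))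

/-- The bitwise disjunction of the shifts of `Y` by `0, d, …, (n - 1) * d` hexadecimal digits. -/
def dilate (Y d : ℕ) : ℕ → ℕ
  | 0 => 0
  | n + 1 => Y ||| dilate Y d n >>> (4 * d)

/-- Checks that in each of the first `N` windows of `n` digits with difference `d`, the numbers
`X` and `Y` differ. -/
def windowsDiffer (n d N X Y : ℕ) : Bool :=
  (dilate (mismatch X Y) d n &&& ((16 ^ N - 1) / 15)) == (16 ^ N - 1) / 15

lemma testBit_of_hexDigit_eq {X Y p : ℕ} (h : hexDigit X p = hexDigit Y p) {b : ℕ} (hb : b < 4) :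
    X.testBit (4 * p + b) = Y.testBit (4 * p + b) := by
  have key (Z : ℕ) : (hexDigit Z p).testBit b = Z.testBit (4 * p + b) := by
    have h16 : (16 : ℕ) ^ p = 2 ^ (4 * p) := by rw [pow_mul]; norm_num
    have : (16 : ℕ) = 2 ^ 4 := by norm_num
    rw [hexDigit, h16, this, Nat.testBit_mod_two_pow, Nat.testBit_div_two_pow]
    simp [hb, add_comm]
  rw [← key, ← key, h]

lemma testBit_mismatch {X Y p : ℕ} (h : (mismatch X Y).testBit (4 * p) = true) :
    hexDigit X p ≠ hexDigit Y p := by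
  intro e
  have h0 := testBit_of_hexDigit_eq e (b := 0) (by norm_num)
  have h1 := testBit_of_hexDigit_eq e (b := 1) (by norm_num)
  have h2 := testBit_of_hexDigit_eq e (b := 2) (by norm_num)
  have h3 := testBit_of_hexDigit_eq e (b := 3) (by norm_num)
  rw [add_zero] at h0
  simp [mismatch, Nat.testBit_or, Nat.testBit_shiftRight, Nat.testBit_xor, h0, h1, h2, h3,
    add_comm _ (4 * p)] at h

lemma exists_testBit_of_dilate {Y d n i : ℕ} (h : (dilate Y d n).testBit (4 * i) = true) :
    ∃ j < n, Y.testBit (4 * (i + j * d)) = true := by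
  induction n generalizing i with
  | zero => simp [dilate] at h
  | succ n ih =>
    rw [dilate, Nat.testBit_or, Bool.or_eq_true] at h
    rcases h with h | h
    · exact ⟨0, by omega, by simpa using h⟩
    · rw [Nat.testBit_shiftRight, ← mul_add] at h
      obtain ⟨j, hj, hY⟩ := ih h
      exact ⟨j + 1, by omega, by rw [← hY]; congr 1; ring⟩

/-- The quotient is `1 + 16 + … + 16 ^ (N - 1)`, a mask for the lowest bit of each digit. -/
lemma testBit_repunit {N i : ℕ} (hi : i < N) : ((16 ^ N - 1) / 15).testBit (4 * i) = true := by
  induction N generalizing i with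
  | zero => omega
  | succ N ih =>
    have hdvd : 15 ∣ 16 ^ N - 1 := by simpa using Nat.sub_dvd_pow_sub_pow 16 1 N
    have hpos : 0 < 16 ^ N := by positivity
    have hrec : (16 ^ (N + 1) - 1) / 15 = 2 ^ 4 * ((16 ^ N - 1) / 15) + 1 := by
      rw [pow_succ]; omega
    rw [hrec, Nat.testBit_two_pow_mul_add _ (by norm_num)]
    rcases Nat.eq_zero_or_pos i with rfl | hpos'
    · simp
    · rw [if_neg (by omega), show 4 * i - 4 = 4 * (i - 1) by omega]
      exact ih (by omega)

/-- Bit `4 * i` of the dilation collects all comparisons in the window at `i`, and the mask reads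
these bits for every `i < N` at once, so a few big-number operations test all windows. -/
lemma windowsDiffer_spec {n d N X Y : ℕ} (h : windowsDiffer n d N X Y = true) {i : ℕ}
    (hi : i < N) : ∃ j < n, hexDigit X (i + j * d) ≠ hexDigit Y (i + j * d) := by
  have h' := congrArg (fun Z => Z.testBit (4 * i)) (eq_of_beq h)
  simp only [Nat.testBit_and, testBit_repunit hi, Bool.and_true] at h'
  obtain ⟨j, hj, hm⟩ := exists_testBit_of_dilate h'
  exact ⟨j, hj, testBit_mismatch hm⟩

lemma hexDigit_shiftRight (X s p : ℕ) : hexDigit (X >>> (4 * s)) p = hexDigit X (p + s) := by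
  rw [hexDigit, hexDigit, Nat.shiftRight_eq_div_pow, pow_mul, Nat.div_div_eq_div_mul,
    add_comm p s, pow_add]
  norm_num

/-- The concatenation of the words of length `L` encoded by `H a`, where `a` runs through a list. -/
def encode (H : Fin 3 → ℕ) (L : ℕ) : List (Fin 3) → ℕ
  | [] => 0
  | a :: V => H a + encode H L V * 16 ^ L

/-- The image of a ternary word under the uniform morphism of length `L` given by `H`. -/
def subst (H : Fin 3 → ℕ) (L : ℕ) (w : ℕ → Fin 3) (p : ℕ) : ℕ := hexDigit (H (w (p / L))) (p % L)

lemma hexDigit_encode {H : Fin 3 → ℕ} {L : ℕ} (hH : ∀ a, H a < 16 ^ L) (V : List (Fin 3)) (p : ℕ)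
    (hp : p < V.length * L) :
    hexDigit (encode H L V) p = subst H L (fun n => V.getD n 0) p := by
  induction V generalizing p with
  | nil => simp at hp
  | cons a V ih =>
    have hL : 0 < L := by
      rcases Nat.eq_zero_or_pos L with rfl | h
      · simp at hp
      · exact h
    rcases lt_or_ge p L with h | h
    · have e : encode H L V * 16 ^ L = 16 ^ p * (16 * (encode H L V * 16 ^ (L - p - 1))) := by
        rw [show (16 : ℕ) ^ L = 16 ^ p * 16 * 16 ^ (L - p - 1) by
          rw [← pow_succ, ← pow_add]; congr 1; omega]
        ring
      simp only [subst, Nat.div_eq_of_lt h, Nat.mod_eq_of_lt h, List.getD_cons_zero]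
      rw [encode, e, hexDigit, Nat.add_mul_div_left _ _ (by positivity), Nat.add_mul_mod_self_left,
        hexDigit]
    · obtain ⟨p, rfl⟩ := Nat.exists_eq_add_of_le' h
      have hp' : p < V.length * L := by
        rw [List.length_cons, Nat.succ_mul] at hp; omega
      have := ih p hp'
      simp only [subst, Nat.add_div_right _ hL, Nat.add_mod_right,
        List.getD_cons_succ] at this ⊢
      rw [← this, encode, hexDigit, add_comm p L, pow_add, ← Nat.div_div_eq_div_mul,
        Nat.add_mul_div_right _ _ (by positivity), Nat.div_eq_of_lt (hH a), zero_add, hexDigit]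

/-! ### Uniform morphisms that map square-free ternary words to `k`-Thue words -/

/-- A word in which every square-free ternary word of length five occurs. -/
def fiveFactorWord : List (Fin 3) :=
  [2, 1, 2, 0, 1, 0, 2, 0, 1, 0, 2, 1, 0, 1, 2, 0, 1, 2, 0, 2, 1, 0, 2, 0, 1, 2, 1, 0, 1, 2, 1, 0,
    2, 1, 2, 0, 2, 1, 2]

/-- A word in which every ternary word of length two occurs. -/
def twoFactorWord : List (Fin 3) := [0, 0, 1, 1, 2, 2, 0, 2, 1, 0]

/-- A square inside five letters has period 1 or 2: `h1`–`h4` exclude the former, `h5` and `h6` the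
latter. -/
lemma exists_fiveFactorWord (a b c d e : Fin 3) (h1 : a ≠ b) (h2 : b ≠ c) (h3 : c ≠ d)
    (h4 : d ≠ e) (h5 : a ≠ c ∨ b ≠ d) (h6 : b ≠ d ∨ c ≠ e) :
    ∃ o < 35, fiveFactorWord.getD o 0 = a ∧ fiveFactorWord.getD (o + 1) 0 = b ∧
      fiveFactorWord.getD (o + 2) 0 = c ∧ fiveFactorWord.getD (o + 3) 0 = d ∧
      fiveFactorWord.getD (o + 4) 0 = e := by
  revert a b c d e
  decide +kernel

lemma exists_twoFactorWord (a b : Fin 3) :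
    ∃ o < 9, twoFactorWord.getD o 0 = a ∧ twoFactorWord.getD (o + 1) 0 = b := by
  revert a b
  decide +kernel

/-- Sufficient conditions for the morphism of length `L` given by `H` to map square-free ternary
words to `k`-Thue words over `q` symbols: bounds on the code words, absence of short repetitions,
synchronization, and separation of the code words by each of their halves. -/
structure IsThueCode (k q L : ℕ) (H : Fin 3 → ℕ) : Prop where
  pos : 0 < L
  lt (a : Fin 3) : H a < 16 ^ L
  hexDigit_lt (a : Fin 3) : ∀ r < L, hexDigit (H a) r < q
  short (d t i : ℕ) : 1 ≤ d → d ≤ k → t * d < 2 * L → ¬ t * d % L = 0 →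
    i + 2 * (t * d) < 39 * L + d →
    ∃ j < t, hexDigit (encode H L fiveFactorWord) (i + j * d) ≠
      hexDigit (encode H L fiveFactorWord) (i + j * d + t * d)
  -- Repeating `a` ten times places a copy of its block opposite every position of `twoFactorWord`.
  -- Only starts `o * L + r` with `o ≤ 8` and `r < d` are needed.
  sync (d s i : ℕ) (a : Fin 3) : 1 ≤ d → d ≤ k → s < L → s ≠ 0 → i < 8 * L + d →
    ∃ j < L / d, hexDigit (encode H L (List.replicate 10 a)) (i + j * d) ≠
      hexDigit (encode H L twoFactorWord) (i + j * d + s)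
  sep (d i : ℕ) (a b : Fin 3) : 1 ≤ d → d ≤ k → a ≠ b → i < L / 2 + d →
    ∃ j < L / (2 * d), hexDigit (H a) (i + j * d) ≠ hexDigit (H b) (i + j * d)

/-- A Boolean test for `IsThueCode`. -/
def thueCodeTest (k q L : ℕ) (H : Fin 3 → ℕ) : Bool :=
  decide (0 < L) &&
  (List.finRange 3).all (fun a => decide (H a < 16 ^ L) &&
    (List.range L).all fun r => decide (hexDigit (H a) r < q)) &&
  (List.range' 1 k).all (fun d =>
    (List.range (2 * L)).all (fun t => decide (2 * L ≤ t * d) || (t * d % L == 0) ||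
      windowsDiffer t d (39 * L + d - 2 * (t * d)) (encode H L fiveFactorWord)
        (encode H L fiveFactorWord >>> (4 * (t * d)))) &&
    (List.finRange 3).all (fun a => (List.range L).all (fun s => (s == 0) ||
      windowsDiffer (L / d) d (8 * L + d) (encode H L (List.replicate 10 a))
        (encode H L twoFactorWord >>> (4 * s))) &&
      (List.finRange 3).all fun b => decide (a = b) ||
        windowsDiffer (L / (2 * d)) d (L / 2 + d) (H a) (H b)))

lemma isThueCode_of_test {k q L : ℕ} {H : Fin 3 → ℕ} (h : thueCodeTest k q L H = true) :
    IsThueCode k q L H := by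
  simp only [thueCodeTest, Bool.and_eq_true, Bool.or_eq_true, List.all_eq_true, decide_eq_true_eq,
    List.mem_finRange, List.mem_range, List.mem_range', true_implies, beq_iff_eq] at h
  obtain ⟨⟨hL, hH⟩, hd⟩ := h
  have mem (d : ℕ) (h1 : 1 ≤ d) (h2 : d ≤ k) : ∃ i < k, d = 1 + 1 * i := ⟨d - 1, by omega, by omega⟩
  refine ⟨hL, fun a => (hH a).1, fun a => (hH a).2, ?_, ?_, ?_⟩
  · intro d t i h1 h2 ht hn hi
    have htd : t ≤ t * d := Nat.le_mul_of_pos_right _ h1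
    obtain (hw | hw) | hw := (hd d (mem d h1 h2)).1 t (by omega)
    · omega
    · exact absurd hw hn
    · obtain ⟨j, hj, hne⟩ := windowsDiffer_spec hw (i := i) (by omega)
      exact ⟨j, hj, by rwa [hexDigit_shiftRight] at hne⟩
  · intro d s i a h1 h2 hs hs0 hi
    obtain hw | hw := ((hd d (mem d h1 h2)).2 a).1 s hs
    · exact absurd hw hs0
    · obtain ⟨j, hj, hne⟩ := windowsDiffer_spec hw hi
      exact ⟨j, hj, by rwa [hexDigit_shiftRight] at hne⟩
  · intro d i a b h1 h2 hab hi
    obtain hw | hw := ((hd d (mem d h1 h2)).2 a).2 b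
    · exact absurd hw hab
    · exact windowsDiffer_spec hw hi

/-- Among `d` consecutive offsets, one lies in the residue class of `i` modulo `d`. -/
lemma exists_offset (d B i lo : ℕ) (hd : 1 ≤ d) (h : i ≤ B + lo) :
    ∃ r < d, ∃ j, B + lo + r = i + j * d := by
  set e := B + lo - i with he
  have hdiv := Nat.div_add_mod (e + (d - 1)) d
  have hlt := Nat.mod_lt (e + (d - 1)) hd
  refine ⟨d - 1 - (e + (d - 1)) % d, by omega, (e + (d - 1)) / d, ?_⟩
  rw [mul_comm ((e + (d - 1)) / d) d]
  omega

lemma subst_block (H : Fin 3 → ℕ) {L : ℕ} (w : ℕ → Fin 3) (B : ℕ) {p : ℕ} (hp : p < L) :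
    subst H L w (B * L + p) = hexDigit (H (w B)) p := by
  have hL : 0 < L := by omega
  rw [subst, mul_comm, Nat.mul_add_div hL, Nat.mul_add_mod, Nat.div_eq_of_lt hp,
    Nat.mod_eq_of_lt hp, add_zero]

/-! ### The three cases for the distance `t * d` -/

namespace IsThueCode

variable {k q L : ℕ} {H : Fin 3 → ℕ}

lemma exists_ne_of_short (hc : IsThueCode k q L H) {w : ℕ → Fin 3} {N : ℕ} (hN : 5 ≤ N)
    (hw : Nonrep 1 N w) {d t i : ℕ} (h1 : 1 ≤ d) (h2 : d ≤ k)
    (hi : i + 2 * (t * d) < N * L + d) (hs : t * d < 2 * L) (hm : t * d % L ≠ 0) :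
    ∃ j < t, subst H L w (i + j * d) ≠ subst H L w (i + j * d + t * d) := by
  have hL := hc.pos
  -- Since `2 * (t * d) < 4 * L`, five blocks from the one containing `i` suffice; near the end of
  -- `w` the choice moves back to `N - 5`.
  obtain ⟨B, hBN, hBi, hiB⟩ :
      ∃ B, B + 5 ≤ N ∧ B * L ≤ i ∧ i + 2 * (t * d) < (B + 5) * L + d := by
    have hdm := Nat.div_add_mod i L
    have hlt := Nat.mod_lt i hL
    rcases le_or_gt (i / L + 5) N with h | h
    · refine ⟨i / L, h, Nat.div_mul_le_self i L, ?_⟩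
      rw [add_mul, mul_comm (i / L)]
      omega
    · refine ⟨N - 5, by omega, ?_, by rwa [Nat.sub_add_cancel hN]⟩
      exact (Nat.mul_le_mul_right L (by omega)).trans (Nat.div_mul_le_self i L)
  have step1 (n : ℕ) (hn : n + 2 ≤ N) : w n ≠ w (n + 1) := by
    obtain ⟨j, hj, hne⟩ := hw 1 1 n le_rfl le_rfl le_rfl (by omega)
    obtain rfl : j = 0 := by omega
    simpa using hne
  have step2 (n : ℕ) (hn : n + 4 ≤ N) : w n ≠ w (n + 2) ∨ w (n + 1) ≠ w (n + 3) := by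
    obtain ⟨j, hj, hne⟩ := hw 1 2 n le_rfl le_rfl (by norm_num) (by omega)
    obtain rfl | rfl : j = 0 ∨ j = 1 := by omega
    · left; simpa using hne
    · right; simpa using hne
  obtain ⟨o, ho, e0, e1, e2, e3, e4⟩ := exists_fiveFactorWord (w B) (w (B + 1)) (w (B + 2))
    (w (B + 3)) (w (B + 4)) (step1 _ (by omega)) (step1 _ (by omega)) (step1 _ (by omega))
    (step1 _ (by omega)) (step2 _ (by omega)) (step2 _ (by omega))
  have transfer (p : ℕ) (hp : p < 5 * L) :
      hexDigit (encode H L fiveFactorWord) (o * L + p) = subst H L w (B * L + p) := by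
    have hpd : p / L < 5 := (Nat.div_lt_iff_lt_mul hL).2 hp
    have hop : o * L + p < 39 * L := by
      have : o * L ≤ 34 * L := Nat.mul_le_mul_right L (by omega)
      omega
    rw [hexDigit_encode hc.lt _ _ (by simpa [fiveFactorWord] using hop), subst, subst,
      mul_comm o, mul_comm B, Nat.mul_add_div hL, Nat.mul_add_div hL, Nat.mul_add_mod,
      Nat.mul_add_mod]
    congr 2
    interval_cases p / L <;> simp_all
  obtain ⟨i, rfl⟩ := Nat.exists_eq_add_of_le hBi
  have hi5 : i + 2 * (t * d) < 5 * L + d := by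
    rw [add_mul] at hiB; omega
  obtain ⟨j, hj, hne⟩ := hc.short d t (o * L + i) h1 h2 hs hm (by
    have : o * L ≤ 34 * L := Nat.mul_le_mul_right L (by omega)
    omega)
  have hjt : j * d + d ≤ t * d := by
    rw [← Nat.succ_mul]; exact Nat.mul_le_mul_right d hj
  refine ⟨j, hj, ?_⟩
  rw [add_assoc (o * L), add_assoc (o * L), transfer _ (by omega), transfer _ (by omega)] at hne
  rwa [add_assoc (B * L), add_assoc (B * L)]

/-- Block `B`, the first to start after `i`, is compared with its shift, which begins at offset `s ≠
0` in block `C`. Square-freeness of `w` plays no role. -/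
lemma exists_ne_of_not_dvd (hc : IsThueCode k q L H) (w : ℕ → Fin 3) {d t : ℕ} (i : ℕ)
    (h1 : 1 ≤ d) (h2 : d ≤ k) (hs : 2 * L ≤ t * d) (hm : t * d % L ≠ 0) :
    ∃ j < t, subst H L w (i + j * d) ≠ subst H L w (i + j * d + t * d) := by
  have hL := hc.pos
  have hdm := Nat.div_add_mod i L
  have hlt := Nat.mod_lt i hL
  have hDm := Nat.div_add_mod (t * d) L
  have hDlt := Nat.mod_lt (t * d) hL
  set B := i / L + 1 with hB
  set C := B + t * d / L with hC
  set s := t * d % L with hs'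
  have hBL : B * L = L * (i / L) + L := by rw [hB]; ring
  have hCL : C * L = B * L + L * (t * d / L) := by rw [hC]; ring
  obtain ⟨o, ho, e0, e1⟩ := exists_twoFactorWord (w C) (w (C + 1))
  obtain ⟨r, hr, j₀, hj₀⟩ := exists_offset d (B * L) i 0 h1 (by omega)
  obtain ⟨j, hj, hne⟩ := hc.sync d s (o * L + r) (w B) h1 h2 hDlt hm (by
    have : o * L ≤ 8 * L := Nat.mul_le_mul_right L (by omega)
    omega)
  have hjd : j * d + d ≤ L := by
    rw [← Nat.succ_mul]; exact (Nat.mul_le_mul_right d hj).trans (Nat.div_mul_le_self L d)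
  have hoL : o * L ≤ 8 * L := Nat.mul_le_mul_right L (by omega)
  -- Block `B` ends at most `2 * L` after `i`, hence within the first half.
  have hjt : (j₀ + j) * d < t * d := by rw [add_mul]; omega
  refine ⟨j₀ + j, lt_of_mul_lt_mul_right hjt (Nat.zero_le d), ?_⟩
  rw [show i + (j₀ + j) * d = B * L + (r + j * d) by rw [add_mul]; omega,
    show B * L + (r + j * d) + t * d = C * L + (r + j * d + s) by omega,
    subst_block H w B (by omega)]
  rw [hexDigit_encode hc.lt _ _ (by simp; omega),
    hexDigit_encode hc.lt _ _ (by simp [twoFactorWord]; omega), add_assoc (o * L),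
    add_assoc (o * L) (r + j * d) s, subst_block H _ o (by omega)] at hne
  have hrep : (List.replicate 10 (w B)).getD o 0 = w B := by
    rw [List.getD_eq_getElem _ _ (by simp; omega), List.getElem_replicate]
  rw [hrep] at hne
  convert hne using 1
  rw [subst, subst, mul_comm o, mul_comm C, Nat.mul_add_div hL, Nat.mul_add_div hL,
    Nat.mul_add_mod, Nat.mul_add_mod]
  have hq : (r + j * d + s) / L < 2 := (Nat.div_lt_iff_lt_mul hL).2 (by omega)
  congr 2
  interval_cases (r + j * d + s) / L <;> simp_all

lemma exists_ne_of_dvd (hc : IsThueCode k q L H) {w : ℕ → Fin 3} {N : ℕ}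
    (hw : Nonrep 1 N w) {d t i m : ℕ} (h1 : 1 ≤ d) (h2 : d ≤ k) (ht : 1 ≤ t)
    (hi : i + 2 * (t * d) < N * L + d) (hm : t * d = m * L) :
    ∃ j < t, subst H L w (i + j * d) ≠ subst H L w (i + j * d + t * d) := by
  by_contra! hall
  have hL := hc.pos
  have hdm := Nat.div_add_mod i L
  have hlt := Nat.mod_lt i hL
  have hm1 : 1 ≤ m := by
    rcases Nat.eq_zero_or_pos m with rfl | h
    · have : 1 ≤ t * d := Nat.mul_pos ht h1
      omega
    · exact h
  -- Half a block, starting at offset `lo` and lying in the first half of the repetition, already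
  -- identifies the letter.
  have block (B lo : ℕ) (hlo : lo ≤ L / 2) (hiB : i ≤ B * L + lo)
      (hBi : B * L + lo + L / (2 * d) * d ≤ i + m * L) : w B = w (B + m) := by
    by_contra hne
    obtain ⟨r, hr, j₀, hj₀⟩ := exists_offset d (B * L) i lo h1 hiB
    obtain ⟨j, hj, hd⟩ := hc.sep d (lo + r) (w B) (w (B + m)) h1 h2 hne (by omega)
    have hjd : j * d + d ≤ L / (2 * d) * d := by
      rw [← Nat.succ_mul]; exact Nat.mul_le_mul_right d hj
    have hLd : L / (2 * d) * d ≤ L / 2 := by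
      rw [← Nat.div_div_eq_div_mul]; exact Nat.div_mul_le_self _ _
    have hjt : (j₀ + j) * d < t * d := by rw [add_mul]; omega
    have := hall (j₀ + j) (lt_of_mul_lt_mul_right hjt (Nat.zero_le d))
    rw [show i + (j₀ + j) * d = B * L + (lo + r + j * d) by rw [add_mul]; omega,
      show B * L + (lo + r + j * d) + t * d = (B + m) * L + (lo + r + j * d) by
        rw [hm, add_mul]; omega,
      subst_block H w _ (by omega), subst_block H w _ (by omega)] at this
    exact hd this
  have hLd : ∀ d, L / (2 * d) * d ≤ L / 2 := fun d => by
    rw [← Nat.div_div_eq_div_mul]; exact Nat.div_mul_le_self _ _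
  -- A witness `j < L / (2 * d)` can exist only if `2 * d ≤ L`.
  have hdL : d ≤ L / 2 := by
    obtain ⟨j, hj, -⟩ := hc.sep d 0 0 1 h1 h2 (by decide) (by omega)
    exact (Nat.le_mul_of_pos_left d (by omega)).trans (hLd d)
  -- If `i` is in the first half of its block, second halves of blocks are compared, starting with
  -- this block; otherwise first halves, starting with the next one.
  rcases le_or_gt (i % L) (L / 2) with ho | ho
  · obtain ⟨r, hr, hne⟩ := hw 1 m (i / L) le_rfl le_rfl hm1 (by
      rw [mul_one]
      refine lt_of_mul_lt_mul_right (a := L) ?_ (Nat.zero_le L)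
      rw [add_mul, add_mul, mul_assoc 2 m L, mul_comm (i / L)]
      omega)
    have hrm : r * L + L ≤ m * L := by
      rw [← Nat.succ_mul]; exact Nat.mul_le_mul_right L hr
    apply hne
    simp only [mul_one]
    refine block _ (L / 2) le_rfl ?_ ?_
    · rw [add_mul, mul_comm (i / L)]; omega
    · have := hLd d
      rw [add_mul, mul_comm (i / L)]; omega
  · obtain ⟨r, hr, hne⟩ := hw 1 m (i / L + 1) le_rfl le_rfl hm1 (by
      rw [mul_one]
      refine lt_of_mul_lt_mul_right (a := L) ?_ (Nat.zero_le L)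
      rw [add_mul, add_mul, add_mul, mul_assoc 2 m L, mul_comm (i / L)]
      omega)
    have hrm : r * L + L ≤ m * L := by
      rw [← Nat.succ_mul]; exact Nat.mul_le_mul_right L hr
    apply hne
    simp only [mul_one]
    refine block _ 0 (Nat.zero_le _) ?_ ?_
    · rw [add_mul, add_mul, mul_comm (i / L)]; omega
    · have := hLd d
      rw [add_mul, add_mul, mul_comm (i / L)]; omega

/-- The image of a square-free ternary word under the morphism is a `k`-Thue word. -/
theorem nonrep_subst (hc : IsThueCode k q L H) {w : ℕ → Fin 3} {N : ℕ} (hN : 5 ≤ N)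
    (hw : Nonrep 1 N w) : Nonrep k (N * L) (subst H L w) := by
  intro d t i h1 h2 ht hi
  by_cases hm : t * d % L = 0
  · exact hc.exists_ne_of_dvd hw h1 h2 ht hi (m := t * d / L)
      (Nat.div_mul_cancel (Nat.dvd_of_mod_eq_zero hm)).symm
  · rcases lt_or_ge (t * d) (2 * L) with hs | hs
    · exact hc.exists_ne_of_short hN hw h1 h2 hi hs hm
    · exact hc.exists_ne_of_not_dvd w i h1 h2 hs hm

lemma subst_lt (hc : IsThueCode k q L H) (w : ℕ → Fin 3) (p : ℕ) : subst H L w p < q :=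
  hc.hexDigit_lt _ _ (Nat.mod_lt p hc.pos)

end IsThueCode

namespace Nonrep

variable {α β : Type*} {k N : ℕ}

lemma mono {x : ℕ → α} (h : Nonrep k N x) {N' : ℕ} (hN : N' ≤ N) : Nonrep k N' x :=
  fun d t i h1 h2 ht hi => h d t i h1 h2 ht (by omega)

lemma comp_of_injective {f : α → β} (hf : Function.Injective f) {x : ℕ → α} (h : Nonrep k N x) :
    Nonrep k N fun n => f (x n) := fun d t i h1 h2 ht hi =>
  let ⟨j, hj, hne⟩ := h d t i h1 h2 ht hi
  ⟨j, hj, hf.ne hne⟩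

lemma codRestrict {q : ℕ} {x : ℕ → ℕ} (hx : ∀ n, x n < q) (h : Nonrep k N x) :
    Nonrep k N fun n => (⟨x n, hx n⟩ : Fin q) := fun d t i h1 h2 ht hi =>
  let ⟨j, hj, hne⟩ := h d t i h1 h2 ht hi
  ⟨j, hj, fun e => hne (congrArg Fin.val e)⟩

end Nonrep

/-! ### The morphisms -/

lemma isThueCode_one : IsThueCode 1 3 11 ![0x20210121021, 0x20210201021, 0x20102012101] :=
  isThueCode_of_test (by decide +kernel)

lemma isThueCode_four : IsThueCode 4 6 24 ![0x423501435210432105432051,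
    0x423504213540123501432051, 0x324053140521345201432051] :=
  isThueCode_of_test (by decide +kernel)

lemma isThueCode_five : IsThueCode 5 7 36 ![0x125463025416325401632401563401256430,
    0x156243051624350162354012653401256430, 0x126534016532406153246015246301256430] :=
  isThueCode_of_test (by decide +kernel)

lemma isThueCode_six : IsThueCode 6 8 40 ![0x6172435607214560327416053271405326170435,
    0x2671405267314506231750423167054326170435, 0x6217035421603574260157342615704326170435] :=
  isThueCode_of_test (by decide +kernel)

lemma isThueCode_seven : IsThueCode 7 9 56 ![
    0x63827150463872510468735210487653210476538210765438217054,
    0x63821754603821546703815462703854126703548216705438217054,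
    0x63821057643820517643805127643058217640583217605438217054] :=
  isThueCode_of_test (by decide +kernel)

lemma isThueCode_eight : IsThueCode 8 10 56 ![
    0x07216389504216738590241638790524138790652138497062138495,
    0x70216839470512869473012859674012389576012438957062138495,
    0x70613249857613042987613540927618345907268134957062138495] :=
  isThueCode_of_test (by decide +kernel)

/-- There are arbitrarily long square-free ternary words. -/
lemma exists_nonrep_one (n : ℕ) : ∃ w : ℕ → Fin 3, Nonrep 1 (5 + n) w := by
  induction n with
  | zero =>
    -- The seed has length five, the least that `nonrep_subst` accepts.
    refine ⟨fun n => [0, 1, 0, 2, 0].getD n 0, ?_⟩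
    intro d t i h1 h2 ht hi
    obtain rfl : d = 1 := by omega
    have key : ∀ t < 3, ∀ i < 5, 1 ≤ t → i + 2 * (t * 1) < 5 + 0 + 1 →
        ∃ j < t, ([0, 1, 0, 2, 0] : List (Fin 3)).getD (i + j * 1) 0 ≠
          ([0, 1, 0, 2, 0] : List (Fin 3)).getD (i + j * 1 + t * 1) 0 := by
      decide
    exact key t (by omega) i (by omega) ht hi
  | succ n ih =>
    obtain ⟨w, hw⟩ := ih
    exact ⟨_, ((isThueCode_one.nonrep_subst (by omega) hw).mono (by omega)).codRestrict
      (isThueCode_one.subst_lt w)⟩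

lemma IsThueCode.exists_nonrep {k q L : ℕ} {H : Fin 3 → ℕ} (hc : IsThueCode k q L H) (n : ℕ) :
    ∃ x : ℕ → Fin q, Nonrep k n x := by
  obtain ⟨w, hw⟩ := exists_nonrep_one n
  have hn : n ≤ (5 + n) * L := (Nat.le_add_left n 5).trans (Nat.le_mul_of_pos_right _ hc.pos)
  exact ⟨_, ((hc.nonrep_subst (by omega) hw).mono hn).codRestrict (hc.subst_lt w)⟩

/-! ### Finite sequences -/

/-- The indices `j` with `i + j * d < n` form an initial segment `j < c`, so `filterMap` only cuts
off a tail and shifts no term. -/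
lemma getElem?_of_getElem?_dSubsequence {α : Type*} {x : ℕ → α} {n d i m : ℕ} {a : α}
    (hd : 1 ≤ d) (h : (dSubsequence ((List.range n).map x) d i)[m]? = some a) :
    i + m * d < n ∧ x (i + m * d) = a := by
  set c := (n + d - 1 - i) / d with hc
  have mem (j : ℕ) : j < c ↔ i + j * d < n := by
    rw [hc, Nat.lt_iff_add_one_le, Nat.le_div_iff_mul_le hd, add_mul]
    omega
  have hcn : c ≤ n := by
    by_contra! hlt
    have := (mem n).1 hlt
    have := Nat.le_mul_of_pos_right n hd
    omega
  have e : dSubsequence ((List.range n).map x) d i =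
      (List.range c).map fun j => x (i + j * d) := by
    rw [dSubsequence, List.length_map, List.length_range]
    have hval : ∀ j, ((List.range n).map x)[i + j * d]? =
        if j < c then some (x (i + j * d)) else none := by
      intro j
      by_cases hj : j < c
      · simp [hj, (mem j).1 hj]
      · simpa [hj] using mt (mem j).2 hj
    simp only [hval]
    obtain ⟨r, hr⟩ := Nat.exists_eq_add_of_le hcn
    rw [hr, List.range_add, List.filterMap_append, List.filterMap_map,
      (List.filterMap_eq_nil_iff (l := List.range r)).2 (by simp), List.append_nil,
      ← List.filterMap_eq_map]
    refine List.filterMap_congr fun j hj => ?_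
    simp [List.mem_range.1 hj]
  rw [e] at h
  simp only [List.getElem?_map, Option.map_eq_some_iff, List.getElem?_eq_some_iff] at h
  obtain ⟨b, ⟨hb, rfl⟩, rfl⟩ := h
  simp only [List.length_range] at hb
  simpa using (mem m).1 hb

lemma isKThue_of_nonrep {α : Type*} {x : ℕ → α} {k n : ℕ} (h : Nonrep k n x) :
    IsKThue k ((List.range n).map x) := by
  rintro d h1 h2 i - r ⟨s, t, hr⟩ ⟨u, hu, rfl⟩
  have hlen : 1 ≤ u.length := List.length_pos_iff.2 hu
  have left (j : ℕ) (hj : j < u.length) :=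
    getElem?_of_getElem?_dSubsequence (x := x) (n := n) (i := i) (m := s.length + j)
      (a := u[j]) h1 (by rw [← hr]; simp [List.getElem?_append, hj])
  have right (j : ℕ) (hj : j < u.length) :=
    getElem?_of_getElem?_dSubsequence (x := x) (n := n) (i := i) (m := s.length + (u.length + j))
      (a := u[j]) h1 (by rw [← hr]; simp [List.getElem?_append, hj])
  -- The last letter of the second `u` lies below `n`; this is the length bound in `Nonrep`, whose
  -- `+ d` reflects that the last term is `(2 * t - 1) * d` after the first.
  obtain ⟨j, hj, hne⟩ := h d u.length (i + s.length * d) h1 h2 hlen (by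
    have := (right (u.length - 1) (by omega)).1
    obtain ⟨l, hl⟩ := Nat.exists_eq_add_of_le hlen
    rw [hl] at this ⊢
    simp only [Nat.add_sub_cancel_left] at this
    ring_nf at this ⊢
    omega)
  refine hne ?_
  have e1 := (left j hj).2
  have e2 := (right j hj).2
  rw [show i + s.length * d + j * d = i + (s.length + j) * d by ring, e1, ← e2]
  congr 1
  ring

theorem theorem2 (k : ℕ) (hk : k ∈ ({4, 5, 6, 7, 8} : Set ℕ))
    (A : Type*) [Fintype A] (hA : Fintype.card A = k + 2) (n : ℕ) :
    ∃ w : List A, w.length = n ∧ IsKThue k w := by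
  obtain ⟨x, hx⟩ : ∃ x : ℕ → Fin (k + 2), Nonrep k n x := by
    rcases hk with rfl | rfl | rfl | rfl | rfl
    · exact isThueCode_four.exists_nonrep n
    · exact isThueCode_five.exists_nonrep n
    · exact isThueCode_six.exists_nonrep n
    · exact isThueCode_seven.exists_nonrep n
    · exact isThueCode_eight.exists_nonrep n
  let f := (Fintype.equivFinOfCardEq hA).symm
  exact ⟨(List.range n).map fun j => f (x j), by simp,
    isKThue_of_nonrep (hx.comp_of_injective f.injective)⟩
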